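/- Let $A:\mathbb{R}^n\to\mathbb{R}^k$ be linear, let $\lambda>0$, and let $\pi_x$ on $\mathbb{R}^n$ and $\pi_{y^\delta}$ on $\mathbb{R}^k$ be Borel probability measures with compact support. Let $K$ be a non-empty compact subset of a finite-dimensional real normed space, and let $(\mathcal{G}_\phi)_{\phi\in K}$ be measurable maps $\mathbb{R}^k\to\mathbb{R}^n$ such that $\mathcal{G}_{\phi_i}\to\mathcal{G}_\phi$ pointwise whenever $\phi_i\to\phi$ in $K$, and $\sup_{\phi\in K}\|\mathcal{G}_\phi\|_\infty<\infty$ (where $\|\cdot\|_\infty$ may be taken to be the $\pi_{y^\delta}$-essential supremum of the Euclidean norm). Let $\mathbb{L}_1$ be the set of all $1$-Lipschitz functions $\mathbb{R}^n\to\mathbb{R}$, and let $$\mathbb{W}_1(\mu,\nu)=\inf_{\gamma\in\Pi(\mu,\nu)}\int\|x_1-x_2\|_2\,\mathrm{d}\gamma(x_1,x_2),$$ where $\Pi(\mu,\nu)$ is the set of measures on $\mathbb{R}^n\times\mathbb{R}^n$ with marginals $\mu$ and $\nu$. For $\phi\in K$ and $\mathcal{R}\in\mathbb{L}_1$ put $$J_1(\mathcal{G}_\phi,\mathcal{R})=\mathbb{E}_{\pi_{y^\delta}}\|y-A\mathcal{G}_\phi(y)\|_2^2+\lambda\big(\mathbb{E}_{\pi_{y^\delta}}[\mathcal{R}(\mathcal{G}_\phi(y))]-\mathbb{E}_{\pi_x}[\mathcal{R}(x)]\big),$$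 $$J_2(\mathcal{G}_\phi)=\mathbb{E}_{\pi_{y^\delta}}\|y-A\mathcal{G}_\phi(y)\|_2^2+\lambda\,\mathbb{W}_1\big(\pi_x,(\mathcal{G}_\phi)_\#\pi_{y^\delta}\big).$$ A pair $(\mathcal{G}_{\phi^*},\mathcal{R}^*)$ with $\phi^*\in K$, $\mathcal{R}^*\in\mathbb{L}_1$ is called optimal for $\inf_{\phi\in K}\sup_{\mathcal{R}\in\mathbb{L}_1}J_1$ if $\phi^*$ minimizes $\phi\mapsto\sup_{\mathcal{R}\in\mathbb{L}_1}J_1(\mathcal{G}_\phi,\mathcal{R})$ over $K$ and $\mathcal{R}^*$ maximizes $J_1(\mathcal{G}_{\phi^*},\cdot)$ over $\mathbb{L}_1$. Then all the expectations above exist and are finite, as is $\mathbb{W}_1(\pi_x,(\mathcal{G}_\phi)_\#\pi_{y^\delta})$; the problems $\inf_{\phi\in K}\sup_{\mathcal{R}\in\mathbb{L}_1}J_1(\mathcal{G}_\phi,\mathcal{R})$ and $\inf_{\phi\in K}J_2(\mathcal{G}_\phi)$ both admit optimal solutions; and $$\inf_{\phi\in K}\sup_{\mathcal{R}\in\mathbb{L}_1}J_1(\mathcal{G}_\phi,\mathcal{R})=\inf_{\phi\in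 K}J_2(\mathcal{G}_\phi).$$ Moreover, $(\mathcal{G}_{\phi^*},\mathcal{R}^*)$ is optimal for the min–max problem if and only if $\mathcal{G}_{\phi^*}$ is optimal for $\inf_{\phi\in K}J_2$ and $\mathcal{R}^*$ is a Kantorovich potential, that is, $$\mathcal{R}^*\in\operatorname*{arg\,max}_{\mathcal{R}\in\mathbb{L}_1}\ \mathbb{E}_{\pi_{y^\delta}}[\mathcal{R}(\mathcal{G}_{\phi^*}(y))]-\mathbb{E}_{\pi_x}[\mathcal{R}(x)].$$ -/

import Mathlib

open MeasureTheory

noncomputable section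

namespace UAR

/-- Transport plans: measures on the product with marginals `μ` and `ν`. -/
def TransportPlans {n : ℕ} (μ ν : Measure (EuclideanSpace ℝ (Fin n))) :
    Set (Measure (EuclideanSpace ℝ (Fin n) × EuclideanSpace ℝ (Fin n))) :=
  {γ | γ.map Prod.fst = μ ∧ γ.map Prod.snd = ν}

/-- The Wasserstein-1 distance: the infimum of the transport cost `∫ ‖x₁ - x₂‖ dγ(x₁, x₂)`
over all transport plans `γ`, with values in `[0, ∞]`. -/
def W1 {n : ℕ} (μ ν : Measure (EuclideanSpace ℝ (Fin n))) : ENNReal :=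
  ⨅ γ ∈ TransportPlans μ ν, ∫⁻ p, ‖p.1 - p.2‖ₑ ∂γ

/-- The set of all 1-Lipschitz functions `ℝⁿ → ℝ`. -/
def Lip1 (n : ℕ) : Set (EuclideanSpace ℝ (Fin n) → ℝ) :=
  {R | LipschitzWith 1 R}

variable {n k : ℕ}

/-- The expected squared data misfit `𝔼 ‖y - A (g y)‖²` of a reconstruction map `g`. -/
def misfit (A : EuclideanSpace ℝ (Fin n) →L[ℝ] EuclideanSpace ℝ (Fin k))
    (πy : Measure (EuclideanSpace ℝ (Fin k)))
    (g : EuclideanSpace ℝ (Fin k) → EuclideanSpace ℝ (Fin n)) : ℝ :=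
  ∫ y, ‖y - A (g y)‖ ^ 2 ∂πy

/-- The dual functional `𝔼 R(g(y)) - 𝔼 R(x)`. -/
def dualGap (πx : Measure (EuclideanSpace ℝ (Fin n))) (πy : Measure (EuclideanSpace ℝ (Fin k)))
    (g : EuclideanSpace ℝ (Fin k) → EuclideanSpace ℝ (Fin n))
    (R : EuclideanSpace ℝ (Fin n) → ℝ) : ℝ :=
  (∫ y, R (g y) ∂πy) - ∫ x, R x ∂πx

/-- The adversarial objective `J₁(g, R)`. -/
def J1 (A : EuclideanSpace ℝ (Fin n) →L[ℝ] EuclideanSpace ℝ (Fin k)) (lam : ℝ)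
    (πx : Measure (EuclideanSpace ℝ (Fin n))) (πy : Measure (EuclideanSpace ℝ (Fin k)))
    (g : EuclideanSpace ℝ (Fin k) → EuclideanSpace ℝ (Fin n))
    (R : EuclideanSpace ℝ (Fin n) → ℝ) : ℝ :=
  misfit A πy g + lam * dualGap πx πy g R

/-- `sup_R J₁(g, R)` over all 1-Lipschitz `R`, as an extended real. -/
def supJ1 (A : EuclideanSpace ℝ (Fin n) →L[ℝ] EuclideanSpace ℝ (Fin k)) (lam : ℝ)
    (πx : Measure (EuclideanSpace ℝ (Fin n))) (πy : Measure (EuclideanSpace ℝ (Fin k)))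
    (g : EuclideanSpace ℝ (Fin k) → EuclideanSpace ℝ (Fin n)) : EReal :=
  ⨆ R ∈ Lip1 n, (J1 A lam πx πy g R : EReal)

/-- The Wasserstein objective `J₂(g) = 𝔼 ‖y - A (g y)‖² + λ W₁(πx, g_# πy)`, as an
extended real. -/
def J2 (A : EuclideanSpace ℝ (Fin n) →L[ℝ] EuclideanSpace ℝ (Fin k)) (lam : ℝ)
    (πx : Measure (EuclideanSpace ℝ (Fin n))) (πy : Measure (EuclideanSpace ℝ (Fin k)))
    (g : EuclideanSpace ℝ (Fin k) → EuclideanSpace ℝ (Fin n)) : EReal :=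
  (misfit A πy g : EReal) + (lam : EReal) * ((W1 πx (πy.map g) : ENNReal) : EReal)

/-- `(φ, R)` is optimal for `inf_φ sup_R J₁(G_φ, R)`: `φ` attains the outer infimum over `K`,
and `R` attains the inner supremum at `φ`. -/
def IsOptimalPair {P : Type*}
    (A : EuclideanSpace ℝ (Fin n) →L[ℝ] EuclideanSpace ℝ (Fin k)) (lam : ℝ)
    (πx : Measure (EuclideanSpace ℝ (Fin n))) (πy : Measure (EuclideanSpace ℝ (Fin k)))
    (K : Set P) (G : P → EuclideanSpace ℝ (Fin k) → EuclideanSpace ℝ (Fin n))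
    (φ : P) (R : EuclideanSpace ℝ (Fin n) → ℝ) : Prop :=
  (φ ∈ K ∧ IsMinOn (fun ψ => supJ1 A lam πx πy (G ψ)) K φ) ∧
    (R ∈ Lip1 n ∧ IsMaxOn (fun S => J1 A lam πx πy (G φ) S) (Lip1 n) R)

/-- `φ` is optimal for `inf_φ J₂(G_φ)` over `K`. -/
def IsOptimalJ2 {P : Type*}
    (A : EuclideanSpace ℝ (Fin n) →L[ℝ] EuclideanSpace ℝ (Fin k)) (lam : ℝ)
    (πx : Measure (EuclideanSpace ℝ (Fin n))) (πy : Measure (EuclideanSpace ℝ (Fin k)))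
    (K : Set P) (G : P → EuclideanSpace ℝ (Fin k) → EuclideanSpace ℝ (Fin n)) (φ : P) : Prop :=
  φ ∈ K ∧ IsMinOn (fun ψ => J2 A lam πx πy (G ψ)) K φ

/-- `R` is a Kantorovich potential between `g_# πy` and `πx`: a maximizer of
`𝔼 R(g(y)) - 𝔼 R(x)` among all 1-Lipschitz functions. -/
def IsKantorovichPotential
    (πx : Measure (EuclideanSpace ℝ (Fin n))) (πy : Measure (EuclideanSpace ℝ (Fin k)))
    (g : EuclideanSpace ℝ (Fin k) → EuclideanSpace ℝ (Fin n))
    (R : EuclideanSpace ℝ (Fin n) → ℝ) : Prop :=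
  R ∈ Lip1 n ∧ IsMaxOn (fun S => dualGap πx πy g S) (Lip1 n) R

end UAR

end

/-!
For a fixed parameter `φ` the inner supremum is computed by Kantorovich–Rubinstein duality,
`W₁(μ, ν) = max {∫ R dν - ∫ R dμ | R 1-Lipschitz}` with `μ = πx` and `ν = (G φ)_# πy`. Hence
`sup_R J₁(G φ, R) = J₂(G φ)` for every `φ ∈ K` (`UAR.supJ1_eq_J2`), so both outer problems have the
same values and the same minimizers. Since `J₁(G φ, ·)` is a positive affine function of the dual
functional, its maximizers are exactly the Kantorovich potentials. A minimizer over the compact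
set `K` exists because, for each `R`, the map `φ ↦ J₁(G φ, R)` is continuous by dominated
convergence (`UAR.continuousOn_J1`), and a supremum of continuous functions is lower
semicontinuous.

Duality is first proved on a compact metric space `X` (`UAR.exists_plan_dual_of_compact`). The dual
problem has a maximizer by Arzelà–Ascoli; let `D` be its value. An optimal plan is a positive linear
functional on `C(X × X)` which takes the value `∫ φ dμ + ∫ ψ dν` at every sum `φ x + ψ y`, and whose
value at the distance function is at most `D`. It is obtained from the M. Riesz extension theorem:
extend integration against `μ ⊗ ν` from the subspace of such sums to a functional nonnegative on
the cone generated by the nonnegative functions and `D - dist`. Nonnegativity on the subspace says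
that `f x + g y ≤ dist x y` implies `∫ f dμ + ∫ g dν ≤ D`, which holds because a 1-Lipschitz function
fits between `g` and `-f`. The Riesz–Markov–Kakutani theorem turns the functional into a measure.
Both measures of the theorem are concentrated on a closed ball, to which the compact case applies;
the potential is extended to the whole space as a 1-Lipschitz function.
-/

namespace UAR

open Set Filter Topology

/-! ### Kantorovich–Rubinstein duality on a compact metric space -/

theorem integrable_of_continuous_of_compactSpace {Y : Type*} [TopologicalSpace Y] [CompactSpace Y]
    [MeasurableSpace Y] [BorelSpace Y] (μ : Measure Y) [IsFiniteMeasure μ] {f : Y → ℝ}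
    (hf : Continuous f) : Integrable f μ :=
  hf.integrable_of_hasCompactSupport (HasCompactSupport.of_compactSpace f)

/-- By Arzelà–Ascoli, the 1-Lipschitz functions vanishing at a fixed point form a compact set of
continuous functions, so the dual problem has a maximizer. -/
theorem exists_isMaxOn_integral_sub_integral {X : Type*} [MetricSpace X] [CompactSpace X]
    [MeasurableSpace X] [BorelSpace X] [Nonempty X] (μ ν : Measure X)
    [IsProbabilityMeasure μ] [IsProbabilityMeasure ν] :
    ∃ R : X → ℝ, LipschitzWith 1 R ∧
      IsMaxOn (fun S : X → ℝ => ∫ x, S x ∂ν - ∫ x, S x ∂μ) {S | LipschitzWith 1 S} R := by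
  obtain ⟨x₀⟩ := ‹Nonempty X›
  let s : Set (BoundedContinuousFunction X ℝ) := {f | LipschitzWith 1 f ∧ f x₀ = 0}
  have hclosed : IsClosed s := by
    have h1 : s = (⋂ x, ⋂ y, {f : BoundedContinuousFunction X ℝ | dist (f x) (f y) ≤ dist x y}) ∩
        {f | f x₀ = 0} := by
      ext f
      simp [s, lipschitzWith_iff_dist_le_mul]
    rw [h1]
    refine (isClosed_iInter fun x => isClosed_iInter fun y => ?_).inter ?_
    · exact isClosed_le (by fun_prop) continuous_const
    · exact isClosed_eq (by fun_prop) continuous_const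
  have hs : IsCompact s := by
    refine BoundedContinuousFunction.arzela_ascoli₂
      (Metric.closedBall 0 (Metric.diam (univ : Set X))) (isCompact_closedBall _ _) s hclosed ?_ ?_
    · rintro f x ⟨hf, hf0⟩
      have := hf.dist_le_mul x x₀
      rw [hf0, NNReal.coe_one, one_mul] at this
      exact this.trans (Metric.dist_le_diam_of_mem (isCompact_univ.isBounded) trivial trivial)
    · exact (LipschitzWith.uniformEquicontinuous _ 1 fun f => f.2.1).equicontinuous
  have hcont : ∀ (ρ : Measure X) [IsProbabilityMeasure ρ],
      Continuous fun f : BoundedContinuousFunction X ℝ => ∫ x, f x ∂ρ := by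
    intro ρ _
    refine (LipschitzWith.of_dist_le_mul (K := 1) fun f g => ?_).continuous
    rw [Real.dist_eq, ← integral_sub (f.integrable ρ) (g.integrable ρ), NNReal.coe_one, one_mul,
      dist_eq_norm]
    simpa using (f - g).norm_integral_le_norm ρ
  obtain ⟨f, hf, hmax⟩ := hs.exists_isMaxOn ⟨0, LipschitzWith.const' (0 : ℝ), rfl⟩
    ((hcont ν).sub (hcont μ)).continuousOn
  refine ⟨f, hf.1, fun S hS => ?_⟩
  have hS : LipschitzWith 1 S := hS
  -- Both integrals shift by `S x₀`, hence `S` may be normalized to vanish at `x₀`.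
  let g : BoundedContinuousFunction X ℝ :=
    BoundedContinuousFunction.mkOfCompact ⟨fun x => S x - S x₀, by have := hS.continuous; fun_prop⟩
  have hg : g ∈ s := by
    refine ⟨LipschitzWith.of_dist_le_mul fun x y => ?_, sub_self _⟩
    simpa [g] using hS.dist_le_mul x y
  have := isMaxOn_iff.1 hmax g hg
  have hint : ∀ (ρ : Measure X) [IsProbabilityMeasure ρ],
      ∫ x, g x ∂ρ = ∫ x, S x ∂ρ - S x₀ := by
    intro ρ _
    simp only [g, BoundedContinuousFunction.mkOfCompact_apply, ContinuousMap.coe_mk]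
    rw [integral_sub (integrable_of_continuous_of_compactSpace ρ hS.continuous)
      (integrable_const _)]
    simp
  simp only [Pi.sub_apply, hint] at this
  change ∫ x, S x ∂ν - ∫ x, S x ∂μ ≤ ∫ x, f x ∂ν - ∫ x, f x ∂μ
  linarith

/-- Every pair `f, g` of continuous functions with `f x + g y ≤ dist x y` is dominated by the
1-Lipschitz function `R y = inf_x (dist x y - f x)`, for which `g ≤ R` and `f ≤ -R`. -/
theorem exists_lipschitz_between {X : Type*} [MetricSpace X] [CompactSpace X] [Nonempty X]
    {f g : X → ℝ} (hf : Continuous f)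
    (h : ∀ x y, f x + g y ≤ dist x y) :
    ∃ R : X → ℝ, LipschitzWith 1 R ∧ (∀ y, g y ≤ R y) ∧ ∀ x, f x ≤ -R x := by
  have hbdd : ∀ y, BddBelow (range fun x => dist x y - f x) := fun y =>
    (isCompact_range (by fun_prop)).bddBelow
  refine ⟨fun y => ⨅ x, (dist x y - f x), LipschitzWith.of_le_add fun y z => ?_, fun y => ?_,
    fun x => ?_⟩
  · rw [← sub_le_iff_le_add]
    refine le_ciInf fun x => ?_
    have h1 := ciInf_le (hbdd y) x
    have h2 := dist_triangle x z y
    rw [dist_comm z y] at h2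
    linarith
  · exact le_ciInf fun x => by linarith [h x y]
  · have := ciInf_le (hbdd x) x
    simp only [dist_self, zero_sub] at this
    linarith

/-- A positive linear functional on `C(Y, ℝ)`, `Y` compact, is integration against a finite
measure. -/
theorem exists_measure_of_positive_functional {Y : Type*} [TopologicalSpace Y] [T2Space Y]
    [CompactSpace Y] [MeasurableSpace Y] [BorelSpace Y] (L : C(Y, ℝ) →ₗ[ℝ] ℝ)
    (hL : ∀ h : C(Y, ℝ), 0 ≤ h → 0 ≤ L h) :
    ∃ γ : Measure Y, IsFiniteMeasure γ ∧ ∀ h : C(Y, ℝ), ∫ p, h p ∂γ = L h := by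
  let e : CompactlySupportedContinuousMap Y ℝ →ₗ[ℝ] C(Y, ℝ) :=
    { toFun := fun f => f.toContinuousMap
      map_add' := fun _ _ => rfl
      map_smul' := fun _ _ => rfl }
  let Λ : CompactlySupportedContinuousMap Y ℝ →ₚ[ℝ] ℝ :=
    PositiveLinearMap.mk₀ (L.comp e) fun f hf => hL _ hf
  refine ⟨RealRMK.rieszMeasure Λ, inferInstance, fun h => ?_⟩
  exact RealRMK.integral_rieszMeasure Λ (CompactlySupportedContinuousMap.continuousMapEquiv h)

/-- **Kantorovich–Rubinstein duality** on a compact metric space in primal–dual form: some plan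
costs at most the dual value of some 1-Lipschitz function. By weak duality both are then optimal. -/
theorem exists_plan_dual_of_compact {X : Type*} [MetricSpace X] [CompactSpace X]
    [MeasurableSpace X] [BorelSpace X] [Nonempty X] (μ ν : Measure X)
    [IsProbabilityMeasure μ] [IsProbabilityMeasure ν] :
    ∃ (R : X → ℝ) (γ : Measure (X × X)), LipschitzWith 1 R ∧ IsFiniteMeasure γ ∧
      γ.map Prod.fst = μ ∧ γ.map Prod.snd = ν ∧
      ∫ p, dist p.1 p.2 ∂γ ≤ ∫ x, R x ∂ν - ∫ x, R x ∂μ := by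
  obtain ⟨R, hR, hmax⟩ := exists_isMaxOn_integral_sub_integral μ ν
  set D : ℝ := ∫ x, R x ∂ν - ∫ x, R x ∂μ with hD
  let c : C(X × X, ℝ) := ⟨fun p => dist p.1 p.2, by fun_prop⟩
  -- The product coupling gives the right values on sums `φ x + ψ y`.
  let L₀ : C(X × X, ℝ) →ₗ[ℝ] ℝ :=
    { toFun := fun h => ∫ p, h p ∂(μ.prod ν)
      map_add' := fun f g => integral_add
        (integrable_of_continuous_of_compactSpace _ f.continuous)
        (integrable_of_continuous_of_compactSpace _ g.continuous)
      map_smul' := fun a f => integral_const_mul a _ }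
  -- The subspace of the functions `φ x + ψ y`.
  let V : Submodule ℝ C(X × X, ℝ) :=
    { carrier := {h | ∃ φ ψ : C(X, ℝ), ∀ p, h p = φ p.1 + ψ p.2}
      add_mem' := by
        rintro f g ⟨φ, ψ, h⟩ ⟨φ', ψ', h'⟩
        exact ⟨φ + φ', ψ + ψ', fun p => by simp [h, h']; ring⟩
      zero_mem' := ⟨0, 0, fun p => by simp⟩
      smul_mem' := by
        rintro a f ⟨φ, ψ, h⟩
        exact ⟨a • φ, a • ψ, fun p => by simp [h]; ring⟩ }
  -- The cone generated by the nonnegative functions and `D - c`.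
  let C : PointedCone ℝ C(X × X, ℝ) :=
    { carrier := {h | ∃ t : ℝ, 0 ≤ t ∧ ∀ p, t * (D - c p) ≤ h p}
      add_mem' := by
        rintro f g ⟨t, ht, h⟩ ⟨t', ht', h'⟩
        exact ⟨t + t', by positivity, fun p => by
          have := h p; have := h' p; rw [ContinuousMap.add_apply]; linarith⟩
      zero_mem' := ⟨0, le_rfl, fun p => by simp⟩
      smul_mem' := by
        rintro ⟨a, ha⟩ f ⟨t, ht, h⟩
        refine ⟨a * t, by positivity, fun p => ?_⟩
        have := mul_le_mul_of_nonneg_left (h p) ha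
        rw [← mul_assoc] at this
        exact this }
  have hsum : ∀ φ ψ : C(X, ℝ), ∫ p : X × X, (φ p.1 + ψ p.2) ∂(μ.prod ν) =
      ∫ x, φ x ∂μ + ∫ y, ψ y ∂ν := by
    intro φ ψ
    rw [integral_add (integrable_of_continuous_of_compactSpace _ (by fun_prop))
      (integrable_of_continuous_of_compactSpace _ (by fun_prop)), integral_fun_fst,
      integral_fun_snd]
    simp
  have hpos : ∀ h : V, (h : C(X × X, ℝ)) ∈ C → 0 ≤ L₀ h := by
    rintro ⟨h, φ, ψ, hh⟩ ⟨t, ht, hC⟩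
    have hL : L₀ h = ∫ x, φ x ∂μ + ∫ y, ψ y ∂ν := by
      rw [← hsum]; exact integral_congr_ae (.of_forall hh)
    rcases ht.eq_or_lt with rfl | ht
    · exact integral_nonneg fun p => by simpa using hC p
    · -- Dividing by `t`, the pair `-φ/t`, `D - ψ/t` is admissible for the dual problem.
      obtain ⟨S, hS, hS1, hS2⟩ := exists_lipschitz_between
        (f := fun x => -(φ x / t)) (g := fun y => D - ψ y / t) (by fun_prop) (by
          intro x y
          have h1 := hC (x, y)
          have h2 : t * (D - dist x y) ≤ φ x + ψ y := by rw [← hh (x, y)]; exact h1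
          rw [← sub_nonneg] at h2 ⊢
          have h3 := div_nonneg h2 ht.le
          have h4 : (φ x + ψ y - t * (D - dist x y)) / t =
            dist x y - (-(φ x / t) + (D - ψ y / t)) := by field_simp; ring
          rwa [h4] at h3)
      have hSmax : ∫ x, S x ∂ν - ∫ x, S x ∂μ ≤ D := hmax hS
      have hSi := hS.continuous
      have i1 : ∫ y, (D - ψ y / t) ∂ν ≤ ∫ y, S y ∂ν :=
        integral_mono (integrable_of_continuous_of_compactSpace _ (by fun_prop))
          (integrable_of_continuous_of_compactSpace _ hSi) hS1
      have i2 : ∫ x, -(φ x / t) ∂μ ≤ ∫ x, -S x ∂μ :=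
        integral_mono (integrable_of_continuous_of_compactSpace _ (by fun_prop))
          (integrable_of_continuous_of_compactSpace _ hSi.neg) hS2
      rw [integral_sub (integrable_const _)
        (integrable_of_continuous_of_compactSpace _ (by fun_prop)), integral_div] at i1
      rw [integral_neg, integral_neg, integral_div] at i2
      simp only [integral_const, probReal_univ, one_smul] at i1
      change 0 ≤ L₀ h
      have h5 : 0 ≤ (∫ x, φ x ∂μ) / t + (∫ y, ψ y ∂ν) / t := by linarith
      rw [hL]
      rw [← add_div] at h5
      have := mul_nonneg h5 ht.le
      rwa [div_mul_cancel₀ _ ht.ne'] at this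
  obtain ⟨L, hLV, hLC⟩ := riesz_extension C (LinearPMap.mk V (L₀.comp V.subtype)) hpos (by
    intro h
    refine ⟨⟨ContinuousMap.const _ ‖h‖, ContinuousMap.const _ ‖h‖, 0, fun p => by simp⟩,
      0, le_rfl, fun p => ?_⟩
    have := (abs_le.1 (h.norm_coe_le_norm p)).1
    simp only [zero_mul, ContinuousMap.add_apply, ContinuousMap.const_apply]
    linarith)
  obtain ⟨γ, hγ, hγL⟩ := exists_measure_of_positive_functional L fun h hh =>
    hLC h ⟨0, le_rfl, fun p => by simpa using hh p⟩
  have hL : ∀ φ ψ : C(X, ℝ), ∫ p : X × X, (φ p.1 + ψ p.2) ∂γ = ∫ x, φ x ∂μ + ∫ y, ψ y ∂ν := by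
    intro φ ψ
    let h : C(X × X, ℝ) := ⟨fun p => φ p.1 + ψ p.2, by fun_prop⟩
    rw [← hsum]
    exact (hγL h).trans (hLV ⟨h, φ, ψ, fun _ => rfl⟩)
  refine ⟨R, γ, hR, hγ, ?_, ?_, ?_⟩
  · refine ext_of_forall_integral_eq_of_IsFiniteMeasure fun f => ?_
    rw [integral_map (by fun_prop) (by fun_prop)]
    simpa using hL f.toContinuousMap 0
  · refine ext_of_forall_integral_eq_of_IsFiniteMeasure fun f => ?_
    rw [integral_map (by fun_prop) (by fun_prop)]
    simpa using hL 0 f.toContinuousMap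
  · -- Since `D - c` lies in the cone, `L c ≤ L D = D`.
    have h1 := hLC (ContinuousMap.const _ D - c) ⟨1, zero_le_one, fun p => by simp⟩
    have h2 : L (ContinuousMap.const _ D) = D := by
      have h : L (ContinuousMap.const _ D) = ∫ _p : X × X, D ∂(μ.prod ν) :=
        hLV ⟨ContinuousMap.const _ D, ContinuousMap.const _ D, 0, fun p => by simp⟩
      simpa using h
    have h3 : ∫ p : X × X, dist p.1 p.2 ∂γ = L c := hγL c
    rw [map_sub, h2] at h1
    linarith


/-! ### Duality for measures concentrated on a compact set -/

/-- Strong duality for measures concentrated on a compact set `s`: restrict to `s`, and extend the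
optimal potential from `s` to a 1-Lipschitz function on the whole space. -/
theorem exists_plan_dual_of_ae_mem {E : Type*} [MetricSpace E] [SecondCountableTopology E]
    [MeasurableSpace E] [BorelSpace E] {s : Set E} (hs : IsCompact s) (μ ν : Measure E)
    [IsProbabilityMeasure μ] [IsProbabilityMeasure ν]
    (hμ : ∀ᵐ x ∂μ, x ∈ s) (hν : ∀ᵐ x ∂ν, x ∈ s) :
    ∃ (R : E → ℝ) (γ : Measure (E × E)), LipschitzWith 1 R ∧
      γ.map Prod.fst = μ ∧ γ.map Prod.snd = ν ∧ 0 ≤ ∫ x, R x ∂ν - ∫ x, R x ∂μ ∧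
      ∫⁻ p, edist p.1 p.2 ∂γ ≤ ENNReal.ofReal (∫ x, R x ∂ν - ∫ x, R x ∂μ) := by
  have hsm := hs.measurableSet
  have : CompactSpace s := isCompact_iff_compactSpace.1 hs
  have hmap : ∀ ρ : Measure E, (∀ᵐ x ∂ρ, x ∈ s) →
      (ρ.comap (Subtype.val : s → E)).map Subtype.val = ρ := fun ρ hρ => by
    rw [map_comap_subtype_coe hsm, Measure.restrict_eq_self_of_ae_mem hρ]
  have hprob : ∀ ρ : Measure E, IsProbabilityMeasure ρ → (∀ᵐ x ∂ρ, x ∈ s) →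
      IsProbabilityMeasure (ρ.comap (Subtype.val : s → E)) := fun ρ _ hρ => by
    have h : IsProbabilityMeasure ((ρ.comap (Subtype.val : s → E)).map Subtype.val) := by
      rwa [hmap ρ hρ]
    exact ⟨by simpa [Measure.map_apply measurable_subtype_coe MeasurableSet.univ] using
      h.measure_univ⟩
  have := hprob μ inferInstance hμ
  have := hprob ν inferInstance hν
  have : Nonempty s := let ⟨x, hx⟩ := hμ.exists; ⟨⟨x, hx⟩⟩
  obtain ⟨R, γ, hR, hγ, hfst, hsnd, hle⟩ :=
    exists_plan_dual_of_compact (μ.comap (Subtype.val : s → E)) (ν.comap (Subtype.val : s → E))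
  obtain ⟨F, hF, hFR⟩ : ∃ F : E → ℝ, LipschitzWith 1 F ∧ ∀ x : s, R x = F x := by
    have hext : ∀ x : s, Function.extend Subtype.val R 0 (x : E) = R x :=
      Subtype.val_injective.extend_apply R 0
    obtain ⟨F, hF, hFR⟩ := LipschitzOnWith.extend_real (K := 1) (s := s)
      (f := Function.extend Subtype.val R 0) fun x hx y hy => by
        have h := hR ⟨x, hx⟩ ⟨y, hy⟩
        rwa [← hext, ← hext] at h
    exact ⟨F, hF, fun x => (hext x).symm.trans (hFR x.2)⟩
  have hint : ∀ ρ : Measure E, (∀ᵐ x ∂ρ, x ∈ s) →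
      ∫ x, R x ∂(ρ.comap (Subtype.val : s → E)) = ∫ x, F x ∂ρ := fun ρ hρ => by
    simp_rw [hFR]
    rw [integral_subtype_comap hsm, Measure.restrict_eq_self_of_ae_mem hρ]
  rw [hint μ hμ, hint ν hν] at hle
  have hval : Measurable (Prod.map Subtype.val Subtype.val : s × s → E × E) := by fun_prop
  refine ⟨F, γ.map (Prod.map Subtype.val Subtype.val), hF, ?_, ?_, ?_, ?_⟩
  · rw [Measure.map_map measurable_fst hval, ← hmap μ hμ, ← hfst,
      Measure.map_map measurable_subtype_coe measurable_fst]
    rfl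
  · rw [Measure.map_map measurable_snd hval, ← hmap ν hν, ← hsnd,
      Measure.map_map measurable_subtype_coe measurable_snd]
    rfl
  · exact (integral_nonneg fun _ => dist_nonneg).trans hle
  · rw [lintegral_map (by fun_prop) hval]
    refine le_trans (le_of_eq ?_) (ENNReal.ofReal_le_ofReal hle)
    rw [ofReal_integral_eq_lintegral_ofReal
      (integrable_of_continuous_of_compactSpace γ (by fun_prop))
      (.of_forall fun _ => dist_nonneg)]
    exact lintegral_congr fun p => edist_dist _ _

/-- Weak duality: every plan costs at least the dual value of every 1-Lipschitz function. -/
theorem ofReal_integral_sub_integral_le_lintegral_edist {E : Type*} [PseudoMetricSpace E]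
    [MeasurableSpace E] [BorelSpace E] {γ : Measure (E × E)} {μ ν : Measure E}
    (hfst : γ.map Prod.fst = μ) (hsnd : γ.map Prod.snd = ν) {R : E → ℝ} (hR : LipschitzWith 1 R)
    (hμ : Integrable R μ) (hν : Integrable R ν) :
    ENNReal.ofReal (∫ x, R x ∂ν - ∫ x, R x ∂μ) ≤ ∫⁻ p, edist p.1 p.2 ∂γ := by
  subst hfst hsnd
  have h1 : Integrable (fun p : E × E => R p.1) γ :=
    (integrable_map_measure hμ.1 measurable_fst.aemeasurable).1 hμ
  have h2 : Integrable (fun p : E × E => R p.2) γ :=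
    (integrable_map_measure hν.1 measurable_snd.aemeasurable).1 hν
  rw [integral_map measurable_fst.aemeasurable hμ.1, integral_map measurable_snd.aemeasurable hν.1,
    ← integral_sub h2 h1]
  calc ENNReal.ofReal (∫ p, (R p.2 - R p.1) ∂γ)
      ≤ ‖∫ p, (R p.2 - R p.1) ∂γ‖ₑ := Real.ofReal_le_enorm _
    _ ≤ ∫⁻ p, ‖R p.2 - R p.1‖ₑ ∂γ := enorm_integral_le_lintegral_enorm _
    _ ≤ ∫⁻ p, edist p.1 p.2 ∂γ := lintegral_mono fun p => by
        have := hR p.2 p.1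
        rwa [edist_eq_enorm_sub, ENNReal.coe_one, one_mul, edist_comm p.2] at this

theorem ae_norm_comp_le {Ω E : Type*} [MeasurableSpace Ω] [NormedAddCommGroup E]
    {μ : Measure Ω} {R : E → ℝ} (hR : LipschitzWith 1 R) {g : Ω → E} {r : ℝ}
    (hr : ∀ᵐ y ∂μ, ‖g y‖ ≤ r) : ∀ᵐ y ∂μ, ‖R (g y)‖ ≤ ‖R 0‖ + r := by
  filter_upwards [hr] with y hy
  have h := hR.dist_le_mul (g y) 0
  rw [dist_zero_right, dist_eq_norm, NNReal.coe_one, one_mul] at h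
  linarith [norm_le_norm_add_norm_sub' (R (g y)) (R 0)]

theorem integrable_comp_of_ae_norm_le {Ω E : Type*} [MeasurableSpace Ω]
    [NormedAddCommGroup E] {μ : Measure Ω} [IsFiniteMeasure μ] {g : Ω → E}
    (hg : AEStronglyMeasurable g μ) {r : ℝ} (hr : ∀ᵐ y ∂μ, ‖g y‖ ≤ r) {R : E → ℝ}
    (hR : LipschitzWith 1 R) : Integrable (fun y => R (g y)) μ :=
  .of_bound (hR.continuous.comp_aestronglyMeasurable hg) _ (ae_norm_comp_le hR hr)

/-- Kantorovich–Rubinstein duality for `W1` between measures with bounded support; the dual maximum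
is nonnegative, so that `ENNReal.ofReal` does not truncate it. -/
theorem exists_lip1_W1_eq {n : ℕ} (μ ν : Measure (EuclideanSpace ℝ (Fin n)))
    [IsProbabilityMeasure μ] [IsProbabilityMeasure ν] {r : ℝ} (hμ : ∀ᵐ x ∂μ, ‖x‖ ≤ r)
    (hν : ∀ᵐ x ∂ν, ‖x‖ ≤ r) :
    ∃ R ∈ Lip1 n, 0 ≤ ∫ x, R x ∂ν - ∫ x, R x ∂μ ∧
      W1 μ ν = ENNReal.ofReal (∫ x, R x ∂ν - ∫ x, R x ∂μ) ∧
      ∀ S ∈ Lip1 n, ∫ x, S x ∂ν - ∫ x, S x ∂μ ≤ ∫ x, R x ∂ν - ∫ x, R x ∂μ := by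
  obtain ⟨R, γ, hR, hfst, hsnd, h0, hle⟩ := exists_plan_dual_of_ae_mem
    (isCompact_closedBall (0 : EuclideanSpace ℝ (Fin n)) r) μ ν (by simpa using hμ)
    (by simpa using hν)
  have hi : ∀ S : EuclideanSpace ℝ (Fin n) → ℝ, LipschitzWith 1 S →
      Integrable S μ ∧ Integrable S ν := fun S hS =>
    ⟨integrable_comp_of_ae_norm_le aestronglyMeasurable_id hμ hS,
      integrable_comp_of_ae_norm_le aestronglyMeasurable_id hν hS⟩
  refine ⟨R, hR, h0, le_antisymm ?_ ?_, fun S hS => ?_⟩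
  · refine (iInf₂_le γ ⟨hfst, hsnd⟩).trans ?_
    simpa only [edist_eq_enorm_sub] using hle
  · refine le_iInf₂ fun γ' hγ' => ?_
    simpa only [edist_eq_enorm_sub] using ofReal_integral_sub_integral_le_lintegral_edist
      hγ'.1 hγ'.2 hR (hi R hR).1 (hi R hR).2
  · rw [← ENNReal.ofReal_le_ofReal_iff h0]
    exact (ofReal_integral_sub_integral_le_lintegral_edist hfst hsnd hS (hi S hS).1
      (hi S hS).2).trans hle

/-! ### The two objectives -/

section Objectives

variable {n k : ℕ} (A : EuclideanSpace ℝ (Fin n) →L[ℝ] EuclideanSpace ℝ (Fin k)) {lam : ℝ}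
  (πx : Measure (EuclideanSpace ℝ (Fin n))) (πy : Measure (EuclideanSpace ℝ (Fin k)))
  {r C : ℝ}

/-- For a reconstruction map with bounded range a Kantorovich potential exists, and its dual value
is the Wasserstein distance. -/
theorem exists_isKantorovichPotential [IsProbabilityMeasure πx] [IsProbabilityMeasure πy]
    {g : EuclideanSpace ℝ (Fin k) → EuclideanSpace ℝ (Fin n)}
    (hg : Measurable g) (hx : ∀ᵐ x ∂πx, ‖x‖ ≤ r) (hgr : ∀ᵐ y ∂πy, ‖g y‖ ≤ r) :
    ∃ R, IsKantorovichPotential πx πy g R ∧ 0 ≤ dualGap πx πy g R ∧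
      W1 πx (πy.map g) = ENNReal.ofReal (dualGap πx πy g R) := by
  have := Measure.isProbabilityMeasure_map (μ := πy) hg.aemeasurable
  obtain ⟨R, hR, h0, hW, hmax⟩ := exists_lip1_W1_eq πx (πy.map g) hx
    ((ae_map_iff hg.aemeasurable (measurableSet_le measurable_norm measurable_const)).2 hgr)
  have hgap : ∀ S ∈ Lip1 n, ∫ x, S x ∂(πy.map g) - ∫ x, S x ∂πx = dualGap πx πy g S := by
    intro S hS
    have hS : LipschitzWith 1 S := hS
    rw [dualGap, integral_map hg.aemeasurable hS.continuous.aestronglyMeasurable]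
  rw [hgap R hR] at h0 hW
  refine ⟨R, ⟨hR, fun S hS => ?_⟩, h0, hW⟩
  have := hmax S hS
  rwa [hgap R hR, hgap S hS] at this

theorem isMaxOn_J1_iff (hlam : 0 < lam)
    (g : EuclideanSpace ℝ (Fin k) → EuclideanSpace ℝ (Fin n))
    (R : EuclideanSpace ℝ (Fin n) → ℝ) :
    IsMaxOn (fun S => J1 A lam πx πy g S) (Lip1 n) R ↔
      IsMaxOn (fun S => dualGap πx πy g S) (Lip1 n) R := by
  simp only [isMaxOn_iff, J1, add_le_add_iff_left, mul_le_mul_iff_right₀ hlam]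

theorem supJ1_eq_J2 [IsProbabilityMeasure πx] [IsProbabilityMeasure πy] (hlam : 0 < lam)
    {g : EuclideanSpace ℝ (Fin k) → EuclideanSpace ℝ (Fin n)}
    (hg : Measurable g) (hx : ∀ᵐ x ∂πx, ‖x‖ ≤ r) (hgr : ∀ᵐ y ∂πy, ‖g y‖ ≤ r) :
    supJ1 A lam πx πy g = J2 A lam πx πy g := by
  obtain ⟨R, ⟨hR, hmax⟩, h0, hW⟩ := exists_isKantorovichPotential πx πy hg hx hgr
  have h1 : supJ1 A lam πx πy g = (J1 A lam πx πy g R : EReal) :=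
    le_antisymm (iSup₂_le fun S hS => EReal.coe_le_coe_iff.2
      (isMaxOn_iff.1 ((isMaxOn_J1_iff A πx πy hlam g R).2 hmax) S hS))
      (le_iSup₂_of_le R hR le_rfl)
  rw [h1, J2, hW, EReal.coe_ennreal_ofReal, max_eq_left h0, J1, EReal.coe_add, EReal.coe_mul]

theorem ae_norm_sq_sub_le {g : EuclideanSpace ℝ (Fin k) → EuclideanSpace ℝ (Fin n)}
    (hy : ∀ᵐ y ∂πy, ‖y‖ ≤ C) (hgr : ∀ᵐ y ∂πy, ‖g y‖ ≤ r) :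
    ∀ᵐ y ∂πy, ‖‖y - A (g y)‖ ^ 2‖ ≤ (C + ‖A‖ * r) ^ 2 := by
  filter_upwards [hy, hgr] with y hy hgy
  rw [norm_pow, norm_norm]
  gcongr
  exact (norm_sub_le _ _).trans (add_le_add hy ((A.le_opNorm _).trans (by gcongr)))

/-- By dominated convergence, for a fixed 1-Lipschitz `R`, the objective `J₁` is continuous in the
parameter. -/
theorem continuousOn_J1 [IsFiniteMeasure πy] {P : Type*} [PseudoMetricSpace P] {K : Set P}
    {G : P → EuclideanSpace ℝ (Fin k) → EuclideanSpace ℝ (Fin n)}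
    (hGmeas : ∀ φ ∈ K, Measurable (G φ))
    (hGcont : ∀ (u : ℕ → P) (φ : P), (∀ i, u i ∈ K) → φ ∈ K → Tendsto u atTop (𝓝 φ) →
      ∀ y, Tendsto (fun i => G (u i) y) atTop (𝓝 (G φ y)))
    (hy : ∀ᵐ y ∂πy, ‖y‖ ≤ C) (hGr : ∀ φ ∈ K, ∀ᵐ y ∂πy, ‖G φ y‖ ≤ r)
    {R : EuclideanSpace ℝ (Fin n) → ℝ} (hR : R ∈ Lip1 n) :
    ContinuousOn (fun φ => J1 A lam πx πy (G φ) R) K := by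
  have hR : LipschitzWith 1 R := hR
  have hRc := hR.continuous
  rw [continuousOn_iff_continuous_domRestrict, continuous_iff_seqContinuous]
  intro u φ hu
  have hlim := hGcont (fun i => u i) φ (fun i => (u i).2) φ.2
    ((continuous_subtype_val.tendsto φ).comp hu)
  have hm : ∀ i, Measurable (G (u i)) := fun i => hGmeas _ (u i).2
  have h1 : Tendsto (fun i => misfit A πy (G (u i))) atTop (𝓝 (misfit A πy (G φ))) := by
    refine tendsto_integral_of_dominated_convergence (fun _ => (C + ‖A‖ * r) ^ 2)
      (fun i => ?_) (integrable_const _) (fun i => ae_norm_sq_sub_le A πy hy (hGr _ (u i).2))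
      (.of_forall fun y => ?_)
    · have := hm i
      exact Measurable.aestronglyMeasurable (by fun_prop)
    · exact ((tendsto_const_nhds.sub ((A.continuous.tendsto _).comp (hlim y))).norm.pow 2)
  have h2 : Tendsto (fun i => ∫ y, R (G (u i) y) ∂πy) atTop (𝓝 (∫ y, R (G φ y) ∂πy)) := by
    refine tendsto_integral_of_dominated_convergence (fun _ => ‖R 0‖ + r)
      (fun i => (hRc.measurable.comp (hm i)).aestronglyMeasurable) (integrable_const _)
      (fun i => ?_) (.of_forall fun y => (hRc.tendsto _).comp (hlim y))
    exact ae_norm_comp_le hR (hGr _ (u i).2)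
  exact h1.add ((h2.sub_const _).const_mul lam)

end Objectives

end UAR

theorem theorem1 {n k : ℕ} {P : Type*} [NormedAddCommGroup P] [NormedSpace ℝ P]
    [FiniteDimensional ℝ P]
    (A : EuclideanSpace ℝ (Fin n) →L[ℝ] EuclideanSpace ℝ (Fin k))
    (lam : ℝ) (hlam : 0 < lam)
    (πx : Measure (EuclideanSpace ℝ (Fin n))) [IsProbabilityMeasure πx]
    (πy : Measure (EuclideanSpace ℝ (Fin k))) [IsProbabilityMeasure πy]
    (hπx : IsCompact πx.support) (hπy : IsCompact πy.support)
    (K : Set P) (hK : IsCompact K) (hKne : K.Nonempty)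
    (G : P → EuclideanSpace ℝ (Fin k) → EuclideanSpace ℝ (Fin n))
    (hGmeas : ∀ φ ∈ K, Measurable (G φ))
    (hGcont : ∀ (u : ℕ → P) (φ : P), (∀ i, u i ∈ K) → φ ∈ K →
      Filter.Tendsto u Filter.atTop (nhds φ) →
      ∀ y, Filter.Tendsto (fun i => G (u i) y) Filter.atTop (nhds (G φ y)))
    (hGbdd : ∃ M : ℝ, ∀ φ ∈ K, ∀ᵐ y ∂πy, ‖G φ y‖ ≤ M) :
    -- all quantities are well defined and finite
    (∀ φ ∈ K, Integrable (fun y => ‖y - A (G φ y)‖ ^ 2) πy ∧ UAR.W1 πx (πy.map (G φ)) < ⊤ ∧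
      ∀ R ∈ UAR.Lip1 n, Integrable (fun y => R (G φ y)) πy ∧ Integrable R πx) ∧
    -- both problems admit an optimal solution
    (∃ φ R, UAR.IsOptimalPair A lam πx πy K G φ R) ∧
    (∃ φ, UAR.IsOptimalJ2 A lam πx πy K G φ) ∧
    -- the optimal values agree
    (⨅ φ ∈ K, ⨆ R ∈ UAR.Lip1 n, (UAR.J1 A lam πx πy (G φ) R : EReal)) =
      (⨅ φ ∈ K, UAR.J2 A lam πx πy (G φ)) ∧
    -- optimal pairs are minimizers of the second problem with any Kantorovich potential
    (∀ φ R, UAR.IsOptimalPair A lam πx πy K G φ R ↔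
      UAR.IsOptimalJ2 A lam πx πy K G φ ∧ UAR.IsKantorovichPotential πx πy (G φ) R) := by
  obtain ⟨M, hM⟩ := hGbdd
  obtain ⟨Cx, hCx⟩ := hπx.isBounded.exists_norm_le
  obtain ⟨C, hC⟩ := hπy.isBounded.exists_norm_le
  have hx : ∀ᵐ x ∂πx, ‖x‖ ≤ max Cx M := by
    filter_upwards [Measure.support_mem_ae (μ := πx)] with x hx
    exact (hCx x hx).trans (le_max_left _ _)
  have hy : ∀ᵐ y ∂πy, ‖y‖ ≤ C := by
    filter_upwards [Measure.support_mem_ae (μ := πy)] with y hy using hC y hy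
  have hGr : ∀ φ ∈ K, ∀ᵐ y ∂πy, ‖G φ y‖ ≤ max Cx M := fun φ hφ =>
    (hM φ hφ).mono fun y h => h.trans (le_max_right _ _)
  have heq : ∀ φ ∈ K, UAR.supJ1 A lam πx πy (G φ) = UAR.J2 A lam πx πy (G φ) := fun φ hφ =>
    UAR.supJ1_eq_J2 A πx πy hlam (hGmeas φ hφ) hx (hGr φ hφ)
  have hmin : ∀ φ ∈ K, (IsMinOn (fun ψ => UAR.supJ1 A lam πx πy (G ψ)) K φ ↔
      IsMinOn (fun ψ => UAR.J2 A lam πx πy (G ψ)) K φ) := by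
    intro φ hφ
    simp only [isMinOn_iff]
    exact forall₂_congr fun ψ hψ => by rw [heq φ hφ, heq ψ hψ]
  have hiff : ∀ φ R, UAR.IsOptimalPair A lam πx πy K G φ R ↔
      UAR.IsOptimalJ2 A lam πx πy K G φ ∧ UAR.IsKantorovichPotential πx πy (G φ) R := fun φ R =>
    and_congr (and_congr_right (hmin φ)) (and_congr_right fun _ =>
      UAR.isMaxOn_J1_iff A πx πy hlam (G φ) R)
  -- The outer objective is lower semicontinuous as a supremum of continuous functions.
  obtain ⟨φ, hφ, hφmin⟩ : ∃ φ ∈ K, IsMinOn (fun ψ => UAR.supJ1 A lam πx πy (G ψ)) K φ :=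
    LowerSemicontinuousOn.exists_isMinOn hKne hK <| lowerSemicontinuousOn_biSup fun R hR =>
      (continuous_coe_real_ereal.comp_continuousOn
        (UAR.continuousOn_J1 A πx πy hGmeas hGcont hy hGr hR)).lowerSemicontinuousOn
  have hJ2 : UAR.IsOptimalJ2 A lam πx πy K G φ := ⟨hφ, (hmin φ hφ).1 hφmin⟩
  refine ⟨fun φ hφ => ⟨?_, ?_, fun R hR => ⟨?_, ?_⟩⟩, ?_, ⟨φ, hJ2⟩, ?_, hiff⟩
  · have := hGmeas φ hφ
    exact .of_bound (Measurable.aestronglyMeasurable (by fun_prop)) _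
      (UAR.ae_norm_sq_sub_le A πy hy (hGr φ hφ))
  · obtain ⟨R, -, -, hW⟩ := UAR.exists_isKantorovichPotential πx πy (hGmeas φ hφ) hx (hGr φ hφ)
    exact hW ▸ ENNReal.ofReal_lt_top
  · exact UAR.integrable_comp_of_ae_norm_le (hGmeas φ hφ).aestronglyMeasurable (hGr φ hφ) hR
  · exact UAR.integrable_comp_of_ae_norm_le aestronglyMeasurable_id hx hR
  · obtain ⟨R, hR, -⟩ := UAR.exists_isKantorovichPotential πx πy (hGmeas φ hφ) hx (hGr φ hφ)
    exact ⟨φ, R, (hiff φ R).2 ⟨hJ2, hR⟩⟩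
  · exact iInf_congr fun φ => iInf_congr fun hφ => heq φ hφ
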